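/- Throughout, all groups are finite, $I$ is an index set, and $\sigma=\{\sigma_i\mid i\in I\}$ is a partition of the set $\mathbb P$ of all primes, that is, $\mathbb P=\bigcup_{i\in I}\sigma_i$ and $\sigma_i\cap\sigma_j=\emptyset$ for all $i\neq j$. For a group $G$, $\sigma(G)$ is the set of those $\sigma_i$ that contain a prime divisor of $|G|$. For a set $\pi$ of primes, a Hall $\pi$-subgroup of $G$ is a subgroup $H$ such that all prime divisors of $|H|$ lie in $\pi$ and no prime divisor of $|G:H|$ lies in $\pi$; $O_\pi(G)$ is the subgroup generated by all normal $\pi$-subgroups of $G$; a $\pi'$-element is an element whose order is divisible by no prime in $\pi$. The group $G$ is *$\sigma$-primary* if it is a $\sigma_i$-group for some $i$; *$\sigma$-nilpotent* if it is a direct product of $\sigma$-primary groups; *$\sigma$-full* if it has a Hall $\sigma_i$-subgroup for every $\sigma_i\in\sigma(G)$. The *$\sigma$-nilpotent residual* $G^{\mathfrak N_\sigma}$ is the intersection of all normal subgroups $N$ of $G$ with $G/N$ $\sigma$-nilpotent. A subgroup $A$ of $G$ is *$\sigma$-permutable* in $G$ if either $A\trianglelefteq G$, or $G$ is $\sigma$-full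 and $AH=HA$ for every Hall $\sigma_i$-subgroup $H$ of $G$ and every $\sigma_i\in\sigma(G)$. The group $G$ is a *$P\sigma T$-group* if $\sigma$-permutability is transitive on $G$: whenever $K$ is $\sigma$-permutable in $G$ and $H\le K$ is $\sigma$-permutable in $K$, then $H$ is $\sigma$-permutable in $G$. The group $G$ *satisfies $\mathbf N_{\pi}$* if, whenever $N$ is a soluble normal subgroup of $G$, every $\pi'$-element of $G$ induces by conjugation a power automorphism in $O_\pi(G/N)$, i.e. maps every subgroup of $O_\pi(G/N)$ onto itself. The group $G$ is *supersoluble* if all its chief factors are cyclic, and a *$\sigma$-$SC$-group* if every chief factor $H/K$ of $G$ with $H\le G^{\mathfrak N_\sigma}$ is simple. **Proposition 2.29.** Let $G$ be a finite $P\sigma T$-group. Then: (i) if $G$ is $\sigma$-full, then $G/R$ satisfies $\mathbf N_{\sigma_i}$ for every normal subgroup $R$ of $G$ and all $i\in I$; (ii) if, for all $i\in I$, all Hall $\sigma_i$-subgroups of $G$ are supersoluble, then $G$ is a $\sigma$-$SC$-group. -/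

import Mathlib

open scoped Pointwise

namespace SigmaGroup

/-- A partition `σ = {σ i | i ∈ I}` of the set of all primes: the cells consist of primes,
cover all primes and are pairwise disjoint. -/
def IsPrimePartition {I : Type*} (σ : I → Set ℕ) : Prop :=
  (⋃ i, σ i) = {p : ℕ | p.Prime} ∧ ∀ i j, i ≠ j → σ i ∩ σ j = ∅

/-- `π(n) ⊆ π`: every prime divisor of `n` lies in `π`. -/
def IsPiNumber (π : Set ℕ) (n : ℕ) : Prop :=
  ∀ p : ℕ, p.Prime → p ∣ n → p ∈ π

/-- `n` is a `π'`-number: no prime divisor of `n` lies in `π`. -/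
def IsPiPrimeNumber (π : Set ℕ) (n : ℕ) : Prop :=
  ∀ p : ℕ, p.Prime → p ∣ n → p ∉ π

/-- `H` is a Hall `π`-subgroup of the (finite) group `G`. -/
def IsHallSubgroup (π : Set ℕ) {G : Type*} [Group G] (H : Subgroup G) : Prop :=
  IsPiNumber π (Nat.card H) ∧ IsPiPrimeNumber π H.index

/-- `σ i ∈ σ(G)`, that is, `σ i ∩ π(|G|) ≠ ∅`. -/
def MemSigma {I : Type*} (σ : I → Set ℕ) (G : Type*) [Group G] (i : I) : Prop :=
  ∃ p ∈ σ i, p.Prime ∧ p ∣ Nat.card G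

/-- `G` is `σ`-primary: it is a `σ i`-group for some `i`. -/
def IsSigmaPrimary {I : Type*} (σ : I → Set ℕ) (G : Type*) [Group G] : Prop :=
  ∃ i, IsPiNumber (σ i) (Nat.card G)

/-- `G` is `σ`-nilpotent: it is a (finite) direct product of `σ`-primary groups. -/
def IsSigmaNilpotent {I : Type*} (σ : I → Set ℕ) (G : Type*) [Group G] : Prop :=
  ∃ (n : ℕ) (H : Fin n → Subgroup G),
    (∀ k, IsSigmaPrimary σ (H k)) ∧ Nonempty (G ≃* (∀ k, H k))

/-- The `σ`-nilpotent residual of `G`: the intersection of all normal subgroups `N` of `G`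
with `σ`-nilpotent quotient `G / N`. -/
def sigmaNilpotentResidual {I : Type*} (σ : I → Set ℕ) (G : Type*) [Group G] : Subgroup G :=
  sInf {N : Subgroup G | ∃ _ : N.Normal, IsSigmaNilpotent σ (G ⧸ N)}

/-- `H / K` is a chief factor of `G`: `K < H` are normal subgroups of `G` and no normal subgroup
of `G` lies strictly between them. -/
structure IsChiefFactor {G : Type*} [Group G] (K H : Subgroup G) : Prop where
  normal_bot : K.Normal
  normal_top : H.Normal
  lt : K < H
  eq_or_eq : ∀ M : Subgroup G, M.Normal → K ≤ M → M ≤ H → M = K ∨ M = H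

/-- The (finite) group `G` is supersoluble: every chief factor of `G` is cyclic. -/
def IsSupersoluble (G : Type*) [Group G] : Prop :=
  ∀ K H : Subgroup G, ∀ h : IsChiefFactor K H,
    haveI := h.normal_bot
    IsCyclic (H ⧸ K.subgroupOf H)

/-- `G` is a `σ`-`SC`-group: every chief factor of `G` below the `σ`-nilpotent residual
is simple. -/
def IsSigmaSCGroup {I : Type*} (σ : I → Set ℕ) (G : Type*) [Group G] : Prop :=
  ∀ K H : Subgroup G, ∀ h : IsChiefFactor K H, H ≤ sigmaNilpotentResidual σ G →
    haveI := h.normal_bot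
    IsSimpleGroup (H ⧸ K.subgroupOf H)

/-- `G` is `σ`-full: it has a Hall `σ i`-subgroup for every `σ i ∈ σ(G)`. -/
def IsSigmaFull {I : Type*} (σ : I → Set ℕ) (G : Type*) [Group G] : Prop :=
  ∀ i, MemSigma σ G i → ∃ H : Subgroup G, IsHallSubgroup (σ i) H

/-- `A` permutes with `B`, that is, `AB = BA`. -/
def Permutes {G : Type*} [Group G] (A B : Subgroup G) : Prop :=
  (A : Set G) * (B : Set G) = (B : Set G) * (A : Set G)

/-- `A` is `σ`-permutable in `G`: either `A` is normal in `G`, or `G` is `σ`-full and `A` permutes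
with all Hall `σ i`-subgroups of `G`, for every `σ i ∈ σ(G)`. -/
def IsSigmaPermutable {I : Type*} (σ : I → Set ℕ) {G : Type*} [Group G] (A : Subgroup G) : Prop :=
  A.Normal ∨ (IsSigmaFull σ G ∧
    ∀ i, MemSigma σ G i → ∀ H : Subgroup G, IsHallSubgroup (σ i) H → Permutes A H)

/-- `G` is a `PσT`-group: `σ`-permutability is transitive on `G`. -/
def IsPSigmaTGroup {I : Type*} (σ : I → Set ℕ) (G : Type*) [Group G] : Prop :=
  ∀ H K : Subgroup G, H ≤ K → IsSigmaPermutable σ (H.subgroupOf K) →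
    IsSigmaPermutable σ K → IsSigmaPermutable σ H

/-- `O_π(G)`: the subgroup generated by all normal `π`-subgroups of `G`. -/
def piCore (π : Set ℕ) (G : Type*) [Group G] : Subgroup G :=
  sSup {N : Subgroup G | N.Normal ∧ IsPiNumber π (Nat.card N)}

/-- `g` induces by conjugation a power automorphism in the subgroup `W` of `G`, that is, it maps
every subgroup of `W` onto itself. -/
def InducesPowerAutomorphism {G : Type*} [Group G] (g : G) (W : Subgroup G) : Prop :=
  ∀ V : Subgroup G, V ≤ W → V.map (MulAut.conj g).toMonoidHom = V

/-- `G` satisfies `N_π`: whenever `N` is a soluble normal subgroup of `G`, the `π'`-elements of `G`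
induce power automorphisms in `O_π(G / N)`. -/
def SatisfiesN (π : Set ℕ) (G : Type*) [Group G] : Prop :=
  ∀ (N : Subgroup G) [N.Normal], Group.IsSolvable N →
    ∀ g : G, IsPiPrimeNumber π (orderOf g) →
      InducesPowerAutomorphism (g : G ⧸ N) (piCore π (G ⧸ N))

end SigmaGroup

namespace SigmaGroup

open Subgroup

/-! ### Arithmetic of π-numbers -/

section Numbers

variable {π : Set ℕ} {m n : ℕ}

/-! Everything rests on one situation: `K ≤ V ≤ W` with `K`, `W` normal in a σ-full `G` and `W/K` a
`σ i`-group. Such a `V` permutes with every Hall subgroup of `W`: those for `σ i` supplement `K`,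
the others lie in `K`. By transitivity `V` is σ-permutable in `G`, and then every Hall `σ
j`-subgroup with `j ≠ i` normalizes `V` (`IsPSigmaTGroup.hall_le_normalizer`).

For (i), the normal closure of these Hall subgroups has `σ i`-index, so its image in a quotient of
`G` contains all elements of order prime to `σ i`, and it normalizes every subgroup of the `σ
i`-core.

For (ii), suppose a chief factor `H/K` is not simple, and let `B/K` be a minimal proper
`H`-invariant subgroup of it. Then `B` is normal in `H`, hence σ-permutable but not normal in `G`;
so `G` is σ-full and some element of a Hall `σ i`-subgroup moves `B`. Comparing `B` with its
conjugate shows that `B/K`, and hence `H/K`, is a `σ i`-group. A Hall `σ i`-subgroup `L` now acts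
irreducibly on `H/K`, the other Hall subgroups leaving every subgroup invariant; so `H/K` is
isomorphic to a chief factor of the supersoluble `L`. It is cyclic, its subgroups are normal in
`G/K`, and it has no proper nontrivial ones. -/

lemma IsPiNumber.of_dvd (h : IsPiNumber π n) (hd : m ∣ n) : IsPiNumber π m :=
  fun p hp hpm => h p hp (hpm.trans hd)

lemma IsPiPrimeNumber.of_dvd (h : IsPiPrimeNumber π n) (hd : m ∣ n) : IsPiPrimeNumber π m :=
  fun p hp hpm => h p hp (hpm.trans hd)

lemma IsPiNumber.mul (hm : IsPiNumber π m) (hn : IsPiNumber π n) : IsPiNumber π (m * n) :=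
  fun p hp hd => (hp.dvd_mul.1 hd).elim (hm p hp) (hn p hp)

lemma IsPiNumber.eq_one (h : IsPiNumber π n) (h' : IsPiPrimeNumber π n) : n = 1 :=
  Nat.eq_one_iff_not_exists_prime_dvd.2 fun p hp hd => h' p hp hd (h p hp hd)

lemma IsPrimePartition.exists_mem {I : Type*} {σ : I → Set ℕ} (hσ : IsPrimePartition σ)
    {p : ℕ} (hp : p.Prime) : ∃ i, p ∈ σ i := by
  have : p ∈ ⋃ i, σ i := by rw [hσ.1]; exact hp
  simpa using this

lemma IsPrimePartition.isPiPrimeNumber {I : Type*} {σ : I → Set ℕ} (hσ : IsPrimePartition σ)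
    {i j : I} (hij : j ≠ i) (h : IsPiNumber (σ j) n) : IsPiPrimeNumber (σ i) n := by
  intro p hp hd hi
  have : p ∈ σ j ∩ σ i := ⟨h p hp hd, hi⟩
  rw [hσ.2 j i hij] at this
  exact this

end Numbers

/-! ### Indices, joins and cores -/

section Index

variable {G : Type*} [Group G]

/-- Second isomorphism theorem inside the normalizer of `A`: `XA/A` is a subgroup of `AB/A ≅ B/(A ∩
B)`. -/
lemma relIndex_dvd_relIndex_of_le_sup {A B X : Subgroup G} (hX : X ≤ A ⊔ B)
    (hXA : X ≤ normalizer (A : Set G)) (hBA : B ≤ normalizer (A : Set G)) :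
    A.relIndex X ∣ A.relIndex B := by
  have hA : A ≤ normalizer (A : Set G) := le_normalizer
  rw [← relIndex_subgroupOf hXA, ← relIndex_subgroupOf hBA]
  set N := normalizer (A : Set G)
  have hn : (A.subgroupOf N).Normal := (normal_subgroupOf_iff_le_normalizer hA).2 le_rfl
  have hle : X.subgroupOf N ≤ A.subgroupOf N ⊔ B.subgroupOf N := by
    rw [← subgroupOf_sup hA hBA]
    exact comap_mono hX
  calc (A.subgroupOf N).relIndex (X.subgroupOf N)
      ∣ (A.subgroupOf N).relIndex (A.subgroupOf N ⊔ B.subgroupOf N) := by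
        rw [← relIndex_subgroupOf hle]
        have : ((A.subgroupOf N).subgroupOf (A.subgroupOf N ⊔ B.subgroupOf N)).Normal :=
          inferInstance
        exact relIndex_dvd_index_of_normal _ _
    _ ∣ _ := by rw [relIndex_sup_left]

lemma relIndex_dvd_index_of_right_normal [Finite G] (L H : Subgroup G) [H.Normal] :
    L.relIndex H ∣ L.index := by
  have h1 := relIndex_mul_relIndex (L ⊓ H) H (H ⊔ L) inf_le_right le_sup_left
  have h2 := relIndex_mul_relIndex (L ⊓ H) L (H ⊔ L) inf_le_left le_sup_right
  rw [relIndex_sup_left, inf_relIndex_right] at h1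
  rw [inf_relIndex_left] at h2
  have h3 : L.relIndex H = L.relIndex (H ⊔ L) :=
    Nat.eq_of_mul_eq_mul_right (Nat.pos_of_ne_zero (index_ne_zero_of_finite (H := H.subgroupOf L)))
      (h1.trans (h2.symm.trans (mul_comm _ _)))
  rw [h3]
  exact relIndex_dvd_index_of_le le_sup_right

/-- The four conditions on `A` pass to joins of two subgroups, so a maximal subgroup satisfying them
contains all of `S`. -/
lemma isPiNumber_relIndex_sSup [Finite G] {π : Set ℕ} {K H : Subgroup G}
    {S : Set (Subgroup G)} (hne : S.Nonempty)
    (hS : ∀ A ∈ S, K ≤ A ∧ A ≤ H ∧ H ≤ normalizer (A : Set G) ∧ IsPiNumber π (K.relIndex A)) :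
    IsPiNumber π (K.relIndex (sSup S)) := by
  obtain ⟨A₀, hA₀⟩ := hne
  obtain ⟨M, ⟨hKM, hMH, hHM, hM⟩, hmax⟩ := exists_maximal_of_wellFoundedGT
    (fun A : Subgroup G => K ≤ A ∧ A ≤ H ∧ H ≤ normalizer (A : Set G) ∧ IsPiNumber π (K.relIndex A))
    ⟨A₀, hS A₀ hA₀⟩
  have hle : sSup S ≤ M := by
    refine sSup_le fun A hA => ?_
    obtain ⟨hKA, hAH, hHA, hA'⟩ := hS A hA
    refine le_sup_right.trans (hmax ⟨hKM.trans le_sup_left, sup_le hMH hAH,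
      (le_inf hHM hHA).trans (normalizer_inf_normalizer_le_normalizer_sup M A), ?_⟩ le_sup_left)
    rw [← relIndex_mul_relIndex K M (M ⊔ A) hKM le_sup_left]
    exact hM.mul (hA'.of_dvd ((relIndex_dvd_relIndex_of_le_sup le_rfl
      ((sup_le hMH hAH).trans hHM) (hAH.trans hHM)).trans (relIndex_dvd_of_le_left A hKM)))
  refine hM.of_dvd ?_
  rw [← relIndex_mul_relIndex K (sSup S) M ((hS A₀ hA₀).1.trans (le_sSup hA₀)) hle]
  exact dvd_mul_right _ _

lemma isPiNumber_card_piCore [Finite G] (π : Set ℕ) : IsPiNumber π (Nat.card (piCore π G)) := by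
  rw [← relIndex_bot_left]
  refine isPiNumber_relIndex_sSup (H := ⊤) ⟨⊥, inferInstance, ?_⟩ ?_
  · intro p hp hd
    simp [hp.ne_one] at hd
  · rintro A ⟨hA, hπ⟩
    rw [relIndex_bot_left]
    exact ⟨bot_le, le_top, (normalizer_eq_top_iff.2 hA).ge, hπ⟩

lemma piCore_normal (π : Set ℕ) : (piCore π G).Normal :=
  sSup_normal _ fun _ hN => hN.1

lemma mem_of_isPiPrimeNumber_orderOf {π : Set ℕ} {C : Subgroup G} [C.Normal]
    (hC : IsPiNumber π C.index) {g : G} (hg : IsPiPrimeNumber π (orderOf g)) : g ∈ C := by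
  rw [← QuotientGroup.eq_one_iff, ← orderOf_eq_one_iff]
  exact (hC.of_dvd (orderOf_dvd_natCard _)).eq_one
    (hg.of_dvd (orderOf_map_dvd (QuotientGroup.mk' C) g))

end Index

/-! ### Hall subgroups and σ-permutability -/

section Hall

variable {I : Type*} {σ : I → Set ℕ} {G : Type*} [Group G]

lemma IsHallSubgroup.map_conj {π : Set ℕ} {T : Subgroup G} (hT : IsHallSubgroup π T) (g : G) :
    IsHallSubgroup π (T.map (MulAut.conj g).toMonoidHom) := by
  refine ⟨?_, ?_⟩
  · rw [Subgroup.card_map_of_injective (MulAut.conj g).injective]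
    exact hT.1
  · have := T.index_map_equiv (MulAut.conj g)
    rw [show T.map (MulAut.conj g).toMonoidHom = T.map (MulAut.conj g : G →* G) from rfl, this]
    exact hT.2

lemma IsHallSubgroup.subgroupOf_normal [Finite G] {π : Set ℕ} {T : Subgroup G}
    (hT : IsHallSubgroup π T) (W : Subgroup G) [W.Normal] :
    IsHallSubgroup π (T.subgroupOf W) := by
  refine ⟨?_, hT.2.of_dvd (relIndex_dvd_index_of_right_normal T W)⟩
  refine hT.1.of_dvd ?_
  rw [← Subgroup.card_map_of_injective W.subtype_injective, subgroupOf_map_subtype]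
  exact Subgroup.card_dvd_of_le inf_le_left

lemma MemSigma.of_subgroup {W : Subgroup G} {i : I} (h : MemSigma σ W i) : MemSigma σ G i := by
  obtain ⟨p, hpi, hp, hd⟩ := h
  exact ⟨p, hpi, hp, hd.trans W.card_subgroup_dvd_card⟩

lemma IsSigmaFull.of_normal [Finite G] (hfull : IsSigmaFull σ G) (W : Subgroup G) [W.Normal] :
    IsSigmaFull σ W := fun i hi =>
  let ⟨_, hT⟩ := hfull i hi.of_subgroup
  ⟨_, hT.subgroupOf_normal W⟩

lemma IsHallSubgroup.eq_bot {T : Subgroup G} {i : I} (hT : IsHallSubgroup (σ i) T)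
    (hi : ¬ MemSigma σ G i) : T = ⊥ := by
  rw [← Subgroup.card_eq_one, Nat.eq_one_iff_not_exists_prime_dvd]
  exact fun p hp hd => hi ⟨p, hT.1 p hp hd, hp, hd.trans T.card_subgroup_dvd_card⟩

lemma isPiNumber_index_of_hall_le (hσ : IsPrimePartition σ) {i : I} {M : Subgroup G}
    (hM : ∀ j, j ≠ i → MemSigma σ G j → ∃ T ≤ M, IsHallSubgroup (σ j) T) :
    IsPiNumber (σ i) M.index := by
  intro p hp hd
  by_contra hpi
  obtain ⟨j, hj⟩ := hσ.exists_mem hp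
  have hji : j ≠ i := fun h => hpi (h ▸ hj)
  obtain ⟨T, hTM, hT⟩ := hM j hji ⟨p, hj, hp, hd.trans M.index_dvd_card⟩
  exact hT.2 p hp (hd.trans (index_dvd_of_le hTM)) hj

lemma eq_top_of_hall_le (hσ : IsPrimePartition σ) {M : Subgroup G}
    (hM : ∀ j, MemSigma σ G j → ∃ T ≤ M, IsHallSubgroup (σ j) T) : M = ⊤ := by
  rw [← index_eq_one, Nat.eq_one_iff_not_exists_prime_dvd]
  intro p hp hd
  obtain ⟨j, hj⟩ := hσ.exists_mem hp
  obtain ⟨T, hTM, hT⟩ := hM j ⟨p, hj, hp, hd.trans M.index_dvd_card⟩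
  exact hT.2 p hp (hd.trans (index_dvd_of_le hTM)) hj

/-- From `tv ∈ VT` one gets `tvt⁻¹ ∈ VT`; its `T`-component falls in `W` because the `V`-component
and `tvt⁻¹` do. -/
lemma Permutes.conj_mem_sup_inf {V T W : Subgroup G} [hW : W.Normal] (h : Permutes V T)
    (hVW : V ≤ W) {t v : G} (ht : t ∈ T) (hv : v ∈ V) :
    ∃ a ∈ V, ∃ b ∈ T ⊓ W, t * v * t⁻¹ = a * b := by
  have : t * v ∈ (V : Set G) * (T : Set G) := by
    rw [show (V : Set G) * (T : Set G) = (T : Set G) * (V : Set G) from h]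
    exact Set.mul_mem_mul ht hv
  obtain ⟨a, ha, b, hb, hab⟩ := this
  replace hab : a * b = t * v := hab
  have heq : t * v * t⁻¹ = a * (b * t⁻¹) := by rw [← hab, mul_assoc]
  refine ⟨a, ha, b * t⁻¹, ⟨T.mul_mem hb (T.inv_mem ht), ?_⟩, heq⟩
  have : b * t⁻¹ = a⁻¹ * (t * v * t⁻¹) := by rw [heq, inv_mul_cancel_left]
  rw [this]
  exact W.mul_mem (W.inv_mem (hVW ha)) (hW.conj_mem _ (hVW hv) _)

variable [Finite G]

lemma isSigmaPermutable_subgroupOf (hσ : IsPrimePartition σ) (hfull : IsSigmaFull σ G) {i : I}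
    {K V W : Subgroup G} [hKn : K.Normal] [W.Normal] (hKV : K ≤ V)
    (hπ : IsPiNumber (σ i) (K.relIndex W)) : IsSigmaPermutable σ (V.subgroupOf W) := by
  refine Or.inr ⟨hfull.of_normal W, fun j _ T hT => ?_⟩
  have hKV' : K.subgroupOf W ≤ V.subgroupOf W := comap_mono hKV
  have hn : (K.subgroupOf W).Normal := inferInstance
  by_cases hji : j = i
  · subst hji
    have htop : K.subgroupOf W ⊔ T = ⊤ := by
      rw [← index_eq_one]
      exact (hπ.of_dvd (index_dvd_of_le le_sup_left)).eq_one
        (hT.2.of_dvd (index_dvd_of_le le_sup_right))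
    have h1 : (V.subgroupOf W : Set W) * (T : Set W) = Set.univ := by
      refine Set.eq_univ_of_univ_subset (le_trans ?_ (Set.mul_subset_mul_right hKV'))
      rw [← normal_mul, htop, coe_top]
    have h2 : (T : Set W) * (V.subgroupOf W : Set W) = Set.univ := by
      refine Set.eq_univ_of_univ_subset (le_trans ?_ (Set.mul_subset_mul_left hKV'))
      rw [← mul_normal, sup_comm, htop, coe_top]
    exact h1.trans h2.symm
  · have hTK : T ≤ K.subgroupOf W := by
      rw [← relIndex_eq_one]
      exact (hπ.of_dvd (relIndex_dvd_index_of_normal (K.subgroupOf W) T)).eq_one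
        (hσ.isPiPrimeNumber hji (hT.1.of_dvd (relIndex_dvd_card _ T)))
    have hTV := hTK.trans hKV'
    rw [Permutes, ← coe_mul_of_left_le_normalizer_right _ _ (hTV.trans le_normalizer),
      ← coe_mul_of_right_le_normalizer_left _ _ (hTV.trans le_normalizer), sup_comm]

lemma IsPSigmaTGroup.hall_le_normalizer (hσ : IsPrimePartition σ) (hG : IsPSigmaTGroup σ G)
    (hfull : IsSigmaFull σ G) {i j : I} (hji : j ≠ i) {K V W : Subgroup G} [K.Normal]
    [hW : W.Normal] (hKV : K ≤ V) (hVW : V ≤ W) (hπ : IsPiNumber (σ i) (K.relIndex W))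
    {T : Subgroup G} (hT : IsHallSubgroup (σ j) T) : T ≤ normalizer (V : Set G) := by
  by_cases hj : MemSigma σ G j
  swap
  · rw [hT.eq_bot hj]
    exact bot_le
  rcases hG V W hVW (isSigmaPermutable_subgroupOf hσ hfull hKV hπ) (Or.inl hW) with hV | ⟨-, hV⟩
  · rw [normalizer_eq_top_iff.2 hV]
    exact le_top
  rw [le_normalizer_iff]
  intro t ht v hv
  obtain ⟨a, ha, b, hb, heq⟩ := (hV j hj T hT).conj_mem_sup_inf hVW ht hv
  -- The index of `K` in `(T ⊓ W)K` divides both a `σ i`-number and a `σ j`-number.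
  have hTW : T ⊓ W ≤ K := by
    rw [← relIndex_eq_one]
    refine (hπ.of_dvd (relIndex_dvd_relIndex_of_le_sup (inf_le_right.trans le_sup_right)
      le_normalizer_of_normal le_normalizer_of_normal)).eq_one
      (hσ.isPiPrimeNumber hji (hT.1.of_dvd ((relIndex_dvd_card _ _).trans
        (Subgroup.card_dvd_of_le inf_le_left))))
  rw [heq]
  exact V.mul_mem ha (hKV (hTW hb))

/-- In a surjective image of a `σ`-full `PσT`-group, the `σ i`-prime elements induce power
automorphisms in the `σ i`-core. -/
lemma IsPSigmaTGroup.inducesPowerAutomorphism_piCore (hσ : IsPrimePartition σ)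
    (hG : IsPSigmaTGroup σ G) (hfull : IsSigmaFull σ G) (i : I) {Q : Type*} [Group Q]
    (f : G →* Q) (hf : Function.Surjective f) {q : Q} (hq : IsPiPrimeNumber (σ i) (orderOf q)) :
    InducesPowerAutomorphism q (piCore (σ i) Q) := by
  have : Finite Q := Finite.of_surjective f hf
  intro V hV
  have := piCore_normal (G := Q) (σ i)
  let S : Set G := {x | ∃ j, j ≠ i ∧ ∃ T : Subgroup G, IsHallSubgroup (σ j) T ∧ x ∈ T}
  have hC : IsPiNumber (σ i) (normalClosure S).index := by
    refine isPiNumber_index_of_hall_le hσ fun j hji hj => ?_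
    obtain ⟨T, hT⟩ := hfull j hj
    exact ⟨T, fun x hx => subset_normalClosure ⟨j, hji, T, hT, hx⟩, hT⟩
  have hCV : normalClosure S ≤ normalizer (V.comap f : Set G) := by
    refine (closure_le _).2 fun y hy => ?_
    obtain ⟨x, ⟨j, hji, T, hT, hx⟩, hxy⟩ := Group.mem_conjugatesOfSet_iff.1 hy
    -- A conjugate of a Hall subgroup is again Hall, so it too normalizes the preimage of `V`.
    obtain ⟨g, rfl⟩ := isConj_iff.1 hxy
    refine hG.hall_le_normalizer hσ hfull hji (K := f.ker) (W := (piCore (σ i) Q).comap f)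
      (f.ker_le_comap V) (comap_mono hV) ?_ (hT.map_conj g) ⟨x, hx, rfl⟩
    rw [relIndex_ker, map_comap_eq_self_of_surjective hf]
    exact isPiNumber_card_piCore (σ i)
  have hn : ((normalClosure S).map f).Normal := normalClosure_normal.map f hf
  obtain ⟨c, hc, rfl⟩ := mem_of_isPiPrimeNumber_orderOf
    (hC.of_dvd (index_map_dvd _ hf)) hq
  refine (mem_normalizer_iff_map_conj_eq (H := V)).1 ?_
  have := le_normalizer_map f (mem_map_of_mem f (hCV hc))
  rwa [map_comap_eq_self_of_surjective hf] at this

end Hall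

/-! ### Chief factors -/

section ChiefFactor

variable {I : Type*} {σ : I → Set ℕ} {G : Type*} [Group G]

lemma isSimpleGroup_quotient {K H : Subgroup G} [hK : K.Normal] (hlt : K < H)
    (h : ∀ A, K ≤ A → A ≤ H → H ≤ normalizer (A : Set G) → A = K ∨ A = H) :
    IsSimpleGroup (H ⧸ K.subgroupOf H) := by
  have : Nontrivial (H ⧸ K.subgroupOf H) := by
    rw [QuotientGroup.nontrivial_iff, Ne, subgroupOf_eq_top]
    exact hlt.not_ge
  refine ⟨fun N hN => ?_⟩
  let B : Subgroup H := N.comap (QuotientGroup.mk' (K.subgroupOf H))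
  have hBn : B.Normal := hN.comap _
  have hKB : K.subgroupOf H ≤ B := by
    conv_lhs => rw [← QuotientGroup.ker_mk' (K.subgroupOf H)]
    exact MonoidHom.ker_le_comap _ N
  have hsub : (B.map H.subtype).subgroupOf H = B :=
    comap_map_eq_self_of_injective H.subtype_injective B
  have hNB : N = B.map (QuotientGroup.mk' (K.subgroupOf H)) :=
    (map_comap_eq_self_of_surjective (QuotientGroup.mk'_surjective _) N).symm
  have hA := h (B.map H.subtype)
    (fun x hx => ⟨⟨x, hlt.le hx⟩, hKB (mem_subgroupOf.2 hx), rfl⟩) (map_subtype_le B)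
    ((normal_subgroupOf_iff_le_normalizer (map_subtype_le B)).1 (hsub.symm ▸ hBn))
  rcases hA with hA | hA
  · left
    rw [hNB, ← hsub, hA, QuotientGroup.map_mk'_self]
  · right
    rw [hNB, ← hsub, hA, subgroupOf_self, map_top_of_surjective _ (QuotientGroup.mk'_surjective _)]

lemma normal_of_le_zpowers {x : G} (hx : (zpowers x).Normal) {A : Subgroup G}
    (hA : A ≤ zpowers x) : A.Normal := by
  refine ⟨fun a ha g => ?_⟩
  obtain ⟨n, rfl⟩ := mem_zpowers_iff.1 (hA ha)
  obtain ⟨m, hm⟩ := mem_zpowers_iff.1 (hx.conj_mem x (mem_zpowers x) g)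
  rw [← conj_zpow, ← hm, ← zpow_mul, mul_comm, zpow_mul]
  exact A.zpow_mem ha m

lemma normal_of_isCyclic_quotient {K H A : Subgroup G} [K.Normal] [hH : H.Normal] {x : G}
    (hx : H.map (QuotientGroup.mk' K) = zpowers (QuotientGroup.mk' K x)) (hKA : K ≤ A)
    (hAH : A ≤ H) : A.Normal := by
  have hn : (zpowers (QuotientGroup.mk' K x)).Normal :=
    hx ▸ hH.map _ (QuotientGroup.mk'_surjective K)
  have := (normal_of_le_zpowers hn (hx ▸ map_mono hAH)).comap (QuotientGroup.mk' K)
  rwa [comap_map_eq_self (by rwa [QuotientGroup.ker_mk'])] at this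

/-- The `G`-conjugates of `A` are normalized by `H` and generate a normal subgroup of `G` strictly
above `K`, hence `H`. -/
lemma IsChiefFactor.isPiNumber_of_minimal [Finite G] {π : Set ℕ} {K H A : Subgroup G}
    (h : IsChiefFactor K H) (hKA : K < A) (hAH : A ≤ H) (hHA : H ≤ normalizer (A : Set G))
    (hπ : IsPiNumber π (K.relIndex A)) : IsPiNumber π (K.relIndex H) := by
  have hK := h.normal_bot
  have hH := h.normal_top
  let S : Set (Subgroup G) := Set.range fun g : G => A.map (MulAut.conj g).toMonoidHom
  have hS : ∀ B ∈ S, K ≤ B ∧ B ≤ H ∧ H ≤ normalizer (B : Set G) ∧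
      IsPiNumber π (K.relIndex B) := by
    rintro _ ⟨g, rfl⟩
    have hKg := mem_normalizer_iff_map_conj_eq.1
      (show g ∈ normalizer (K : Set G) from le_normalizer_of_normal (K := ⊤) trivial)
    have hHg := mem_normalizer_iff_map_conj_eq.1
      (show g ∈ normalizer (H : Set G) from le_normalizer_of_normal (K := ⊤) trivial)
    refine ⟨?_, ?_, ?_, ?_⟩
    · exact hKg.ge.trans (map_mono hKA.le)
    · exact (map_mono hAH).trans hHg.le
    · exact hHg.ge.trans ((map_mono hHA).trans (le_normalizer_map _))
    · have := relIndex_map_map_of_injective (f := (MulAut.conj g).toMonoidHom) K A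
        (MulAut.conj g).injective
      rw [← this] at hπ
      exact hKg ▸ hπ
  have hAS : A ∈ S := ⟨1, by ext; simp⟩
  have hn : (sSup S).Normal := by
    refine ⟨fun a ha g => ?_⟩
    have hmap : (sSup S).map (MulAut.conj g).toMonoidHom ≤ sSup S := by
      rw [map_le_iff_le_comap]
      refine sSup_le ?_
      rintro _ ⟨k, rfl⟩
      rw [← map_le_iff_le_comap, map_map]
      refine le_sSup ⟨g * k, ?_⟩
      ext; simp [mul_assoc]
    exact hmap ⟨a, ha, rfl⟩
  have hle : A ≤ sSup S := le_sSup hAS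
  rcases h.eq_or_eq _ hn (hKA.le.trans hle) (sSup_le fun B hB => (hS B hB).2.1) with h1 | h1
  · exact absurd (h1 ▸ hle) hKA.not_ge
  · rw [← h1]
    exact isPiNumber_relIndex_sSup ⟨A, hAS⟩ hS

/-- Since `V = K(V ∩ L)`, the factor `V/K` is `L`-isomorphic to `(V ∩ L)/(K ∩ L)`. Minimality of `V`
makes the latter a chief factor of `L`, hence cyclic. -/
lemma IsSupersoluble.exists_generator {L K V : Subgroup G} [K.Normal] (hL : IsSupersoluble L)
    (hLV : L ≤ normalizer (V : Set G)) (hKV : K < V) (hV : V ≤ K ⊔ (V ⊓ L))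
    (hmin : ∀ A, K < A → A ≤ V → L ≤ normalizer (A : Set G) → A = V) :
    ∃ x ∈ V, V.map (QuotientGroup.mk' K) = zpowers (QuotientGroup.mk' K x) := by
  have hVn : (V.subgroupOf L).Normal := normal_subgroupOf_of_le_normalizer hLV
  have hchief : IsChiefFactor (K.subgroupOf L) (V.subgroupOf L) := by
    refine ⟨inferInstance, hVn, (comap_mono hKV.le).lt_of_not_ge fun hle => ?_, ?_⟩
    · refine hKV.not_ge (hV.trans (sup_le le_rfl fun x hx => ?_))
      exact mem_subgroupOf.1 (hle (show (⟨x, hx.2⟩ : L) ∈ V.subgroupOf L from hx.1))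
    · intro M hM hKM hMV
      have hMV' : M.map L.subtype ≤ V := by
        rintro _ ⟨m, hm, rfl⟩
        exact hMV hm
      have hMn : L ≤ normalizer (M.map L.subtype : Set G) := by
        refine le_normalizer_iff.2 ?_
        rintro l hl _ ⟨m, hm, rfl⟩
        exact ⟨⟨l, hl⟩ * m * ⟨l, hl⟩⁻¹, hM.conj_mem m hm _, rfl⟩
      by_cases hMK : M.map L.subtype ≤ K
      · left
        exact le_antisymm (fun m hm => hMK ⟨m, hm, rfl⟩) hKM
      · right
        -- `KM = V` forces `M = V ∩ L` by Dedekind's law, as `K ∩ L ≤ M`.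
        have hKMV := hmin (K ⊔ M.map L.subtype)
          (le_sup_left.lt_of_not_ge fun hle => hMK (le_sup_right.trans hle))
          (sup_le hKV.le hMV')
          ((le_inf le_normalizer_of_normal hMn).trans
            (normalizer_inf_normalizer_le_normalizer_sup _ _))
        refine le_antisymm hMV fun y hy => ?_
        have hy' : (y : G) ∈ K ⊔ M.map L.subtype := hKMV ▸ hy
        rw [← SetLike.mem_coe, normal_mul] at hy'
        obtain ⟨k, hk, _, ⟨m, hm, rfl⟩, hkm⟩ := hy'
        replace hkm : k * (m : G) = y := hkm
        have hk' : y * m⁻¹ ∈ M := hKM (mem_subgroupOf.2 (by simpa [← hkm] using hk))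
        simpa using M.mul_mem hk' hm
  obtain ⟨z, hz⟩ := (hL _ _ hchief).exists_generator
  obtain ⟨x, rfl⟩ := QuotientGroup.mk_surjective z
  refine ⟨((x : L) : G), x.2, le_antisymm ?_ ?_⟩
  · rintro _ ⟨v, hv, rfl⟩
    have hv' := hV hv
    rw [← SetLike.mem_coe, normal_mul] at hv'
    obtain ⟨k, hk, y, hy, rfl⟩ := hv'
    obtain ⟨n, hn⟩ := mem_zpowers_iff.1 (hz (QuotientGroup.mk ⟨⟨y, hy.2⟩, hy.1⟩))
    rw [← QuotientGroup.mk_zpow, QuotientGroup.eq, mem_subgroupOf, mem_subgroupOf] at hn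
    refine mem_zpowers_iff.2 ⟨n, ?_⟩
    have hk1 : QuotientGroup.mk' K k = 1 := (QuotientGroup.eq_one_iff k).2 hk
    change _ = QuotientGroup.mk' K (k * y)
    rw [map_mul, hk1, one_mul, ← map_zpow]
    exact QuotientGroup.eq.2 (by simpa using hn)
  · rw [zpowers_le]
    exact mem_map_of_mem _ x.2

variable [Finite G]

lemma IsPSigmaTGroup.eq_or_eq_of_isPiNumber (hσ : IsPrimePartition σ) (hG : IsPSigmaTGroup σ G)
    (hfull : IsSigmaFull σ G)
    (hsup : ∀ (i : I) (H : Subgroup G), IsHallSubgroup (σ i) H → IsSupersoluble H)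
    {K H : Subgroup G} (h : IsChiefFactor K H) {i : I} (hπ : IsPiNumber (σ i) (K.relIndex H))
    {A : Subgroup G} (hKA : K ≤ A) (hAH : A ≤ H) : A = K ∨ A = H := by
  have hK := h.normal_bot
  have hH := h.normal_top
  have hi : MemSigma σ G i := by
    have hne : K.relIndex H ≠ 1 := fun h1 => h.lt.not_ge (relIndex_eq_one.1 h1)
    obtain ⟨p, hp, hd⟩ := Nat.exists_prime_and_dvd hne
    exact ⟨p, hπ p hp hd, hp, hd.trans ((relIndex_dvd_card K H).trans H.card_subgroup_dvd_card)⟩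
  obtain ⟨L, hL⟩ := hfull i hi
  obtain ⟨V, ⟨hKV, hVH, hLV⟩, hmin⟩ := exists_minimal_of_wellFoundedLT
    (fun V : Subgroup G => K < V ∧ V ≤ H ∧ L ≤ normalizer (V : Set G))
    ⟨H, h.lt, le_rfl, le_normalizer_of_normal⟩
  have hVn : V.Normal := by
    rw [← normalizer_eq_top_iff]
    refine eq_top_of_hall_le hσ fun j hj => ?_
    by_cases hji : j = i
    · exact ⟨L, hLV, hji ▸ hL⟩
    · obtain ⟨T, hT⟩ := hfull j hj
      exact ⟨T, hG.hall_le_normalizer hσ hfull hji hKV.le hVH hπ hT, hT⟩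
  have hVeq : V = H := (h.eq_or_eq V hVn hKV.le hVH).resolve_left hKV.ne'
  subst hVeq
  -- The index of `K(V ∩ L)` in `V` is a `σ i`-number through `K`, and prime to `σ i` because `V ∩
  -- L` is Hall in `V`.
  have hKL : V ≤ K ⊔ (V ⊓ L) := by
    rw [← relIndex_eq_one]
    refine (hπ.of_dvd (relIndex_dvd_of_le_left V le_sup_left)).eq_one ?_
    have := hL.2.of_dvd (relIndex_dvd_index_of_right_normal L V)
    rw [← inf_relIndex_right, inf_comm] at this
    exact this.of_dvd (relIndex_dvd_of_le_left V le_sup_right)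
  obtain ⟨x, -, hx⟩ := (hsup i L hL).exists_generator hLV hKV hKL fun B hB hBV hLB =>
    hBV.antisymm (hmin ⟨hB, hBV, hLB⟩ hBV)
  exact h.eq_or_eq A (normal_of_isCyclic_quotient hx hKA hAH) hKA hAH

lemma IsPSigmaTGroup.isSimpleGroup_chiefFactor (hσ : IsPrimePartition σ)
    (hG : IsPSigmaTGroup σ G)
    (hsup : ∀ (i : I) (H : Subgroup G), IsHallSubgroup (σ i) H → IsSupersoluble H)
    {K H : Subgroup G} [hK : K.Normal] (h : IsChiefFactor K H) :
    IsSimpleGroup (H ⧸ K.subgroupOf H) := by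
  have hH := h.normal_top
  have hperm : ∀ A ≤ H, H ≤ normalizer (A : Set G) → IsSigmaPermutable σ A := fun A hAH hHA =>
    hG A H hAH (Or.inl (normal_subgroupOf_of_le_normalizer hHA)) (Or.inl hH)
  refine isSimpleGroup_quotient h.lt fun A hKA hAH hHA => ?_
  by_contra! hA
  obtain ⟨B, ⟨hKB, hBA, hHB⟩, hmin⟩ := exists_minimal_of_wellFoundedLT
    (fun B : Subgroup G => K < B ∧ B ≤ A ∧ H ≤ normalizer (B : Set G))
    ⟨A, hKA.lt_of_ne' hA.1, le_rfl, hHA⟩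
  have hBH : B ≤ H := hBA.trans hAH
  have hBn : ¬ B.Normal := fun hn => by
    rcases h.eq_or_eq B hn hKB.le hBH with h1 | h1
    · exact hKB.ne' h1
    · exact hA.2 (hAH.antisymm (h1 ▸ hBA))
  rcases hperm B hBH hHB with hn | ⟨hfull, hB⟩
  · exact hBn hn
  obtain ⟨i, hi, L, hL, l, hl, hlB⟩ : ∃ i, MemSigma σ G i ∧ ∃ L : Subgroup G,
      IsHallSubgroup (σ i) L ∧ ∃ l ∈ L, ¬ B ≤ B.map (MulAut.conj l).toMonoidHom := by
    by_contra! hcon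
    refine hBn (normalizer_eq_top_iff.1 (eq_top_of_hall_le hσ fun j hj => ?_))
    obtain ⟨L, hL⟩ := hfull j hj
    refine ⟨L, le_normalizer_iff.2 fun l hl b hb => ?_, hL⟩
    -- Taking `l⁻¹` turns `B ≤ l⁻¹Bl` into `lBl⁻¹ ≤ B`.
    obtain ⟨b', hb', hbb⟩ := hcon j hj L hL l⁻¹ (L.inv_mem hl) hb
    rw [← hbb]
    simpa [mul_assoc] using hb'
  set C := B.map (MulAut.conj l).toMonoidHom with hC
  have hKl := mem_normalizer_iff_map_conj_eq.1
    (show l ∈ normalizer (K : Set G) from le_normalizer_of_normal (K := ⊤) trivial)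
  have hHl := mem_normalizer_iff_map_conj_eq.1
    (show l ∈ normalizer (H : Set G) from le_normalizer_of_normal (K := ⊤) trivial)
  have hKC : K ≤ C := hKl.ge.trans (map_mono hKB.le)
  have hCH : C ≤ H := (map_mono hBH).trans hHl.le
  have hHC : H ≤ normalizer (C : Set G) :=
    hHl.ge.trans ((map_mono hHB).trans (le_normalizer_map _))
  -- Otherwise `B ⊓ C` lies strictly above `K` and is normalized by `H`, so minimality of `B` gives
  -- `B ≤ C`.
  have hinf : B ⊓ C = K := by
    by_contra hne
    exact hlB ((hmin ⟨(le_inf hKB.le hKC).lt_of_ne' hne, inf_le_left.trans hBA,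
      (le_inf hHB hHC).trans inf_normalizer_le_normalizer_inf⟩ inf_le_left).trans inf_le_right)
  have hCsup : C ≤ B ⊔ (L ⊓ H) := by
    rintro _ ⟨b, hb, rfl⟩
    obtain ⟨a, ha, c, hc, heq⟩ := (hB i hi L hL).conj_mem_sup_inf hBH hl hb
    change l * b * l⁻¹ ∈ _
    rw [heq]
    exact mul_mem_sup ha hc
  have hdvd := relIndex_dvd_relIndex_of_le_sup hCsup (hCH.trans hHB) (inf_le_right.trans hHB)
  -- `|B : K| = |C : K| = |C : B ∩ C|` divides the order of `L ∩ H`, since `C ≤ B(L ∩ H)`.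
  have hπ : IsPiNumber (σ i) (K.relIndex B) := by
    have h1 : K.relIndex B = K.relIndex C := by
      have := relIndex_map_map_of_injective (f := (MulAut.conj l).toMonoidHom) K B
        (MulAut.conj l).injective
      rw [← this]
      exact congrArg (fun X : Subgroup G => X.relIndex C) hKl
    rw [h1, ← hinf, inf_relIndex_right]
    exact hL.1.of_dvd (hdvd.trans ((relIndex_dvd_card _ _).trans
      (Subgroup.card_dvd_of_le inf_le_left)))
  have hend := hG.eq_or_eq_of_isPiNumber hσ hfull hsup h
    (h.isPiNumber_of_minimal hKB hBH hHB hπ) hKA hAH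
  exact hend.elim hA.1 hA.2

end ChiefFactor

end SigmaGroup

theorem proposition2p29 {I : Type*} (σ : I → Set ℕ) (hσ : SigmaGroup.IsPrimePartition σ)
    (G : Type*) [Group G] [Finite G] (hG : SigmaGroup.IsPSigmaTGroup σ G) :
    (SigmaGroup.IsSigmaFull σ G →
      ∀ (R : Subgroup G) [R.Normal] (i : I), SigmaGroup.SatisfiesN (σ i) (G ⧸ R)) ∧
    ((∀ (i : I) (H : Subgroup G), SigmaGroup.IsHallSubgroup (σ i) H →
        SigmaGroup.IsSupersoluble H) →
      SigmaGroup.IsSigmaSCGroup σ G) := by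
  refine ⟨fun hfull R _ i N _ _ g hg => ?_, fun hsup K H h _ => ?_⟩
  · exact hG.inducesPowerAutomorphism_piCore hσ hfull i
      ((QuotientGroup.mk' N).comp (QuotientGroup.mk' R))
      ((QuotientGroup.mk'_surjective N).comp (QuotientGroup.mk'_surjective R))
      (hg.of_dvd (orderOf_map_dvd (QuotientGroup.mk' N) g))
  · have := h.normal_bot
    exact hG.isSimpleGroup_chiefFactor hσ hsup h
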